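/- Let $G=(V,E)$ be a finite simple connected graph of order $n$ with exactly one cycle (a connected unicycle graph). A leaf is a vertex of degree one, and a support vertex is a neighbor of a leaf; let $l(G)$ and $s(G)$ denote the numbers of leaves and of support vertices of $G$. A set $S\subseteq V$ is a global offensive alliance if every vertex $v\in V\setminus S$ has a neighbor in $S$ and satisfies $|N[v]\cap S|\ge |N[v]\setminus S|$, where $N[v]$ is the closed neighborhood of $v$; let $\gamma_o(G)$ be the minimum cardinality of a global offensive alliance of $G$. Let $\mathcal{G}$ be the family of all graphs that are isomorphic to the last term $G_k$ of a finite sequence of graphs $G_1,\dots,G_k$ ($k\ge 1$) of the following kind. The graph $G_1$ is obtained from a cycle $x_1x_2\cdots x_{2m}$ of even length $2m\ge 4$ by adding $m$ new vertices $y_1,\dots,y_m$ and the $m$ edges $x_{2i-1}y_i$ $(1\le i\le m)$. For $1\le i<k$, the graph $G_{i+1}$ is obtained from $G_i$ by one of two operations: - $O1$: add one new vertex and join it by an edge to a support vertex of $G_i$; - $O2$: add a new path $P_3=abc$ and join $a$ by an edge to a support vertex of $G_i$. Then $\gamma_o(G)=\dfrac{n-l(G)+s(G)}{3}$ if and only if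 $G\in\mathcal{G}$. -/

import Mathlib

namespace Alliance

universe u

/-- The closed neighborhood `N[v]`. -/
def closedNbhd {V : Type*} (G : SimpleGraph V) (v : V) : Set V :=
  insert v (G.neighborSet v)

/-- The set of leaves: the vertices of degree one. -/
def leaves {V : Type*} (G : SimpleGraph V) : Set V :=
  {v | (G.neighborSet v).ncard = 1}

/-- The set of support vertices: the neighbors of leaves. -/
def supports {V : Type*} (G : SimpleGraph V) : Set V :=
  {v | ∃ u ∈ leaves G, G.Adj v u}

/-- Every vertex outside `S` has a neighbor in `S`. -/
def IsDominating {V : Type*} (G : SimpleGraph V) (S : Set V) : Prop :=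
  ∀ v ∉ S, ∃ u ∈ S, G.Adj v u

/-- Global offensive alliance: a dominating set `S` with `|N[v] ∩ S| ≥ |N[v] - S|` for each
vertex `v` outside `S`. -/
def IsGOA {V : Type*} (G : SimpleGraph V) (S : Set V) : Prop :=
  IsDominating G S ∧ ∀ v ∉ S, (closedNbhd G v \ S).ncard ≤ (closedNbhd G v ∩ S).ncard

/-- The global offensive alliance number. The set of sizes is never empty, because the whole
vertex set is a global offensive alliance. -/
noncomputable def goaNumber {V : Type*} (G : SimpleGraph V) : ℕ :=
  sInf {k | ∃ S : Set V, IsGOA G S ∧ S.ncard = k}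

/-- `G` has exactly one cycle; cycles given as closed walks are the same cycle when they have the
same edges. -/
def IsUnicycle {V : Type*} (G : SimpleGraph V) : Prop :=
  ∃ (u : V) (p : G.Walk u u), p.IsCycle ∧
    ∀ (v : V) (q : G.Walk v v), q.IsCycle → ∀ e, e ∈ q.edges ↔ e ∈ p.edges

/-- The even cycle with vertices `0, …, 2m - 1`, with one pendant edge at each of the vertices
`0, 2, …, 2m - 2`. The new vertex `inr i` is joined to the cycle vertex `2i`. -/
def baseGraph (m : ℕ) : SimpleGraph (Fin (2 * m) ⊕ Fin m) where
  Adj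
    | .inl a, .inl b => (SimpleGraph.cycleGraph (2 * m)).Adj a b
    | .inl a, .inr i => a.val = 2 * i.val
    | .inr i, .inl a => a.val = 2 * i.val
    | .inr _, .inr _ => False
  symm := ⟨by
    rintro (a | i) (b | j) h
    · exact SimpleGraph.Adj.symm h
    · exact h
    · exact h
    · exact h⟩
  loopless := ⟨by
    rintro (a | i) h
    · exact SimpleGraph.irrefl _ h
    · exact h⟩

/-- The disjoint union of `G` and `P` together with one new edge, which joins the vertex `v`
of `G` to the vertex `a` of `P`. -/
def attach {V W : Type*} (G : SimpleGraph V) (v : V) (P : SimpleGraph W) (a : W) :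
    SimpleGraph (V ⊕ W) where
  Adj
    | .inl x, .inl y => G.Adj x y
    | .inl x, .inr y => x = v ∧ y = a
    | .inr x, .inl y => y = v ∧ x = a
    | .inr x, .inr y => P.Adj x y
  symm := ⟨by
    rintro (x | x) (y | y) h
    · exact SimpleGraph.Adj.symm h
    · exact h
    · exact h
    · exact SimpleGraph.Adj.symm h⟩
  loopless := ⟨by
    rintro (x | x) h
    · exact SimpleGraph.irrefl _ h
    · exact SimpleGraph.irrefl _ h⟩

/-- The family of unicycle graphs, closed under isomorphism, that is obtained from the base graphs
by attaching to a support vertex either a new vertex (a path on one vertex) or a path on three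
vertices by one of its ends. -/
inductive Family : {V : Type u} → SimpleGraph V → Prop
  | base {V : Type u} {G : SimpleGraph V} (m : ℕ) (hm : 2 ≤ m) (e : baseGraph m ≃g G) :
      Family G
  | opO1 {V W : Type u} {G : SimpleGraph V} {H : SimpleGraph W} (hG : Family G) (v : V)
      (hv : v ∈ supports G) (e : attach G v (SimpleGraph.pathGraph 1) 0 ≃g H) : Family H
  | opO2 {V W : Type u} {G : SimpleGraph V} {H : SimpleGraph W} (hG : Family G) (v : V)
      (hv : v ∈ supports G) (e : attach G v (SimpleGraph.pathGraph 3) 0 ≃g H) : Family H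

end Alliance

/-! A unicycle graph enters only through connectedness and the degree sum $2n$ (`UniConn`). In a
minimum alliance, trade the leaves for the support vertices: this gives $S'$, no larger, which
contains every support vertex and no leaf, and every remaining non-leaf has two neighbors in $S'$.
Counting degrees into $S'$ gives $n\le l+2|S'|$, and $s\le|S'|$, so $n+s\le l+3\gamma_o$. Equality
forces $S'$ to be the set of supports and every edge to have exactly one end in it, with degrees one
or two on the other side: this is a `Core`. Conversely, a core is itself an alliance of the extremal
size (`goaNumber_eq_iff_exists_core`).

It remains to match cores with the family. Both operations extend a core. In the other direction,
induct on the order. Two leaves at one support undo O1, and a support of degree two with a single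
leaf undoes O2. If neither occurs, counting makes every core vertex cubic. The cycle then alternates
between the two sides, and with one leaf at each of its core vertices it already exhausts the
connected graph. -/

namespace Alliance

/-! ### Degrees, connected graphs with as many edges as vertices, double counting -/

section Counting

open scoped Classical

variable {V W : Type*}

/-- The degree of a vertex, as the cardinality of the neighbor set. -/
noncomputable def deg (G : SimpleGraph V) (v : V) : ℕ := (G.neighborSet v).ncard

theorem mem_leaves_iff {G : SimpleGraph V} {v : V} : v ∈ leaves G ↔ deg G v = 1 := Iff.rfl

theorem neighborSet_iso {G : SimpleGraph V} {H : SimpleGraph W} (e : G ≃g H) (v : V) :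
    H.neighborSet (e v) = e '' G.neighborSet v := by
  ext w
  obtain ⟨w, rfl⟩ := e.surjective w
  simpa using e.map_adj_iff

theorem deg_iso {G : SimpleGraph V} {H : SimpleGraph W} (e : G ≃g H) (v : V) :
    deg H (e v) = deg G v := by
  rw [deg, neighborSet_iso, Set.ncard_image_of_injective _ e.injective, deg]

theorem eq_of_deg_eq_one {G : SimpleGraph V} {v a b : V} (h : deg G v = 1) (ha : G.Adj v a)
    (hb : G.Adj v b) : a = b := by
  obtain ⟨c, hc⟩ := Set.ncard_eq_one.1 h
  have h1 : a ∈ G.neighborSet v := ha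
  have h2 : b ∈ G.neighborSet v := hb
  rw [hc] at h1 h2
  exact h1.trans h2.symm

/-- A connected graph whose degree sum is twice the order, hence with as many edges as vertices. -/
structure UniConn [Fintype V] (G : SimpleGraph V) : Prop where
  conn : G.Connected
  sum_deg : ∑ v, deg G v = 2 * Fintype.card V

/-- A bipartition of `G` into a part `A` of vertices adjacent to leaves and a part of vertices of
degree at most two. -/
structure Core (G : SimpleGraph V) (A : Set V) : Prop where
  bip : ∀ ⦃x y⦄, G.Adj x y → (x ∈ A ↔ y ∉ A)
  leaf : ∀ ⦃x⦄, x ∈ A → ∃ u, G.Adj x u ∧ deg G u = 1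
  low : ∀ ⦃x⦄, x ∉ A → deg G x = 1 ∨ deg G x = 2

theorem UniConn.iso [Fintype V] [Fintype W] {G : SimpleGraph V} {H : SimpleGraph W}
    (e : G ≃g H) (h : UniConn G) : UniConn H := by
  refine ⟨e.connected_iff.1 h.conn, ?_⟩
  rw [← Fintype.card_congr e.toEquiv, ← h.sum_deg]
  exact (Fintype.sum_equiv e.toEquiv _ _ fun v => (deg_iso e v).symm).symm

theorem Core.iso {G : SimpleGraph V} {H : SimpleGraph W} (e : G ≃g H) {A : Set V}
    (h : Core G A) : Core H (e.symm ⁻¹' A) := by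
  refine ⟨fun x y hxy => h.bip (e.symm.map_adj_iff.2 hxy), fun x hx => ?_, fun x hx => ?_⟩
  · obtain ⟨u, hu, hd⟩ := h.leaf hx
    refine ⟨e u, ?_, by rw [deg_iso, hd]⟩
    have := e.map_adj_iff.2 hu
    simpa using this
  · rw [← deg_iso e.symm]
    exact h.low hx

theorem mem_of_connected_of_closed {G : SimpleGraph V} (hG : G.Connected) {S : Set V} {x : V}
    (hx : x ∈ S) (hS : ∀ x ∈ S, ∀ y, G.Adj x y → y ∈ S) (y : V) : y ∈ S := by
  obtain ⟨p⟩ := hG.preconnected x y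
  induction p with
  | nil => exact hx
  | cons h _ ih => exact ih (hS _ hx _ h)

theorem UniConn.deg_ne_one_of_adj [Fintype V] {G : SimpleGraph V} (h : UniConn G) {u v : V}
    (huv : G.Adj u v) (hu : deg G u = 1) : deg G v ≠ 1 := by
  intro hv
  have hall : ∀ y, y ∈ ({u, v} : Set V) := by
    refine mem_of_connected_of_closed h.conn (x := u) (by simp) ?_
    rintro x (rfl | rfl) y hy
    · right; exact eq_of_deg_eq_one hu hy huv
    · left; exact eq_of_deg_eq_one hv hy huv.symm
  have h1 : ∀ y, deg G y = 1 := fun y => by rcases hall y with rfl | rfl <;> assumption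
  have h2 := h.sum_deg
  have : 0 < Fintype.card V := Fintype.card_pos_iff.2 ⟨u⟩
  simp [h1] at h2
  omega

theorem deg_eq_degree [Fintype V] (G : SimpleGraph V) (v : V) : deg G v = G.degree v := by
  rw [deg, Set.ncard_eq_toFinset_card', ← G.card_neighborFinset_eq_degree]
  rfl

theorem sum_deg_eq [Fintype V] (G : SimpleGraph V) : ∑ v, deg G v = 2 * G.edgeFinset.card := by
  simp_rw [deg_eq_degree]
  exact G.sum_degrees_eq_twice_card_edges

/-- An edge of the cycle is not a bridge, and every cycle contains it. Deleting it therefore leaves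
a tree, with $n-1$ edges. -/
theorem uniConn_of_isUnicycle [Fintype V] {G : SimpleGraph V} (hG : G.Connected)
    (h : IsUnicycle G) : UniConn G := by
  refine ⟨hG, ?_⟩
  obtain ⟨u, p, hp, hq⟩ := h
  obtain ⟨e, he⟩ : ∃ e, e ∈ p.edges := by
    refine List.exists_mem_of_ne_nil _ fun h0 => ?_
    have := hp.three_le_length
    rw [← p.length_edges, h0] at this
    simp at this
  have heG : e ∈ G.edgeSet := p.edges_subset_edgeSet he
  have hnb : ¬ G.IsBridge e := fun hb =>
    (SimpleGraph.isBridge_iff_forall_cycle_notMem heG).1 hb p hp he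
  obtain ⟨x, y⟩ := e
  have hT : (G.deleteEdges {s(x, y)}).IsTree := by
    refine ⟨hG.connected_delete_edge_of_not_isBridge hnb, fun v q hc => ?_⟩
    have hle : G.deleteEdges {s(x, y)} ≤ G := G.deleteEdges_le _
    have h1 := (hq v (q.mapLe hle) (hc.mapLe hle) s(x, y)).2 he
    have h2 : s(x, y) ∈ q.edges := by simpa using h1
    have h3 := q.edges_subset_edgeSet h2
    simp at h3
  have hc := hT.card_edgeFinset
  rw [sum_deg_eq, ← hc]
  congr 1
  have h1 : (G.deleteEdges {s(x, y)}).edgeFinset = G.edgeFinset.erase s(x, y) := by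
    ext e
    simp [and_comm]
  rw [h1]
  exact (Finset.card_erase_add_one (by simpa using heG)).symm

theorem ncard_eq_sum [Fintype V] (S : Set V) : S.ncard = ∑ v, if v ∈ S then 1 else 0 := by
  rw [Finset.sum_boole, Set.ncard_eq_toFinset_card']
  simp

/-- The number of neighbors of `v` in `S`. -/
noncomputable def degIn (G : SimpleGraph V) (S : Set V) (v : V) : ℕ := (G.neighborSet v ∩ S).ncard

theorem degIn_le_deg [Fintype V] (G : SimpleGraph V) (S : Set V) (v : V) :
    degIn G S v ≤ deg G v := Set.ncard_le_ncard Set.inter_subset_left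

theorem sum_degIn [Fintype V] (G : SimpleGraph V) (S : Set V) :
    ∑ v, degIn G S v = ∑ v, if v ∈ S then deg G v else 0 := by
  have h1 : ∀ v, degIn G S v = ∑ w, if G.Adj v w ∧ w ∈ S then 1 else 0 := fun v => by
    
    simp only [degIn, ncard_eq_sum, Set.mem_inter_iff, SimpleGraph.mem_neighborSet]
  have h2 : ∀ v, deg G v = ∑ w, if G.Adj v w then 1 else 0 := fun v => by
    
    simp only [deg, ncard_eq_sum, SimpleGraph.mem_neighborSet]
  simp_rw [h1]
  rw [Finset.sum_comm]
  refine Finset.sum_congr rfl fun w _ => ?_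
  by_cases hw : w ∈ S
  · simp [hw, h2, G.adj_comm]
  · simp [hw]

end Counting


/-! ### The lower bound and its equality case -/

section Bounds

open scoped Classical

variable {V : Type*} {G : SimpleGraph V}

theorem closedNbhd_inter {S : Set V} {v : V} (hv : v ∉ S) :
    (closedNbhd G v ∩ S).ncard = degIn G S v := by
  rw [closedNbhd, Set.insert_inter_of_notMem hv, degIn]

theorem goaNumber_le {S : Set V} (h : IsGOA G S) : goaNumber G ≤ S.ncard :=
  Nat.sInf_le ⟨S, h, rfl⟩

theorem exists_isGOA_ncard_eq (G : SimpleGraph V) : ∃ S, IsGOA G S ∧ S.ncard = goaNumber G :=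
  Nat.sInf_mem (s := {k | ∃ S : Set V, IsGOA G S ∧ S.ncard = k})
    ⟨_, Set.univ, ⟨fun _ hv => absurd trivial hv, fun _ hv => absurd trivial hv⟩, rfl⟩

variable [Fintype V]

theorem closedNbhd_diff {S : Set V} {v : V} (hv : v ∉ S) :
    (closedNbhd G v \ S).ncard + degIn G S v = deg G v + 1 := by
  rw [closedNbhd, Set.insert_sdiff_of_notMem _ hv, Set.ncard_insert_of_notMem (by simp), degIn, deg,
    ← Set.ncard_inter_add_ncard_sdiff_eq_ncard (G.neighborSet v) S]
  ring

theorem UniConn.notMem_leaves_of_mem_supports (hU : UniConn G) {v : V} (hv : v ∈ supports G) :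
    v ∉ leaves G := by
  obtain ⟨u, hu, ha⟩ := hv
  exact fun h => hU.deg_ne_one_of_adj ha h hu

theorem UniConn.deg_pos (hU : UniConn G) (v : V) : 0 < deg G v := by
  by_contra h0
  have h0 : deg G v = 0 := by omega
  have hN : G.neighborSet v = ∅ := (Set.ncard_eq_zero).1 h0
  have hall : ∀ y, y ∈ ({v} : Set V) := by
    refine mem_of_connected_of_closed hU.conn (x := v) (by simp) ?_
    rintro x rfl y hy
    have : y ∈ G.neighborSet x := hy
    simp [hN] at this
  have h1 : ∀ y, deg G y = 0 := fun y => by rcases hall y with rfl; exact h0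
  have h2 := hU.sum_deg
  have : 0 < Fintype.card V := Fintype.card_pos_iff.2 ⟨v⟩
  simp [h1] at h2
  omega

/-- The leaves of an alliance are replaced by the support vertices. -/
theorem ncard_exchange_le (hU : UniConn G) {S : Set V} (hS : IsGOA G S) :
    ((S \ leaves G) ∪ supports G).ncard ≤ S.ncard := by
  have h1 : ((S \ leaves G) ∪ supports G) = (S \ leaves G) ∪ (supports G \ S) := by
    ext v
    have := hU.notMem_leaves_of_mem_supports (v := v)
    simp only [Set.mem_union, Set.mem_sdiff]
    tauto
  have h2 : (supports G \ S).ncard ≤ (S ∩ leaves G).ncard := by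
    -- A support vertex outside `S` cannot dominate its leaf, so that leaf lies in `S`. Distinct
    -- supports have distinct leaves.
    have hex : ∀ v : V, ∃ u, v ∈ supports G → u ∈ leaves G ∧ G.Adj v u := fun v => by
      by_cases hv : v ∈ supports G
      · obtain ⟨u, hu, ha⟩ := hv
        exact ⟨u, fun _ => ⟨hu, ha⟩⟩
      · exact ⟨v, fun h => absurd h hv⟩
    choose f hf using hex
    refine Set.ncard_le_ncard_of_injOn f ?_ ?_
    · intro v hv
      obtain ⟨hl, ha⟩ := hf v hv.1
      refine ⟨?_, hl⟩
      by_contra hfS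
      obtain ⟨w, hw, hadj⟩ := hS.1 _ hfS
      exact hv.2 (eq_of_deg_eq_one hl hadj ha.symm ▸ hw)
    · intro v hv w hw hvw
      obtain ⟨hl, ha⟩ := hf v hv.1
      obtain ⟨_, hb⟩ := hf w hw.1
      exact eq_of_deg_eq_one hl ha.symm (hvw ▸ hb.symm)
  rw [h1]
  refine (Set.ncard_union_le _ _).trans ?_
  have := Set.ncard_inter_add_ncard_sdiff_eq_ncard S (leaves G)
  omega

theorem two_le_degIn_exchange (hU : UniConn G) {S : Set V} (hS : IsGOA G S) {v : V}
    (hv : v ∉ (S \ leaves G) ∪ supports G) (hl : v ∉ leaves G) :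
    2 ≤ degIn G ((S \ leaves G) ∪ supports G) v := by
  have hvS : v ∉ S := fun h => hv (Or.inl ⟨h, hl⟩)
  have h1 := hS.2 v hvS
  rw [closedNbhd_inter hvS] at h1
  have h2 := closedNbhd_diff (G := G) hvS
  have h3 : deg G v ≠ 1 := hl
  have h4 := hU.deg_pos v
  -- Since `v` is not a support vertex, the exchange removes none of its neighbors. The alliance
  -- condition reads `deg + 1 ≤ 2 * degIn` with `deg ≥ 2`, hence `degIn ≥ 2`.
  have h5 : degIn G S v ≤ degIn G ((S \ leaves G) ∪ supports G) v := by
    refine Set.ncard_le_ncard fun w hw => ⟨hw.1, Or.inl ⟨hw.2, fun hwl => hv (Or.inr ?_)⟩⟩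
    exact ⟨w, hwl, hw.1⟩
  omega

/-- A set `S` which contains all support vertices and no leaves, such that every further vertex has
two neighbors in `S`, contains at least half of the vertices that are not leaves. -/
theorem card_le_of_two_le_degIn (hU : UniConn G) {S : Set V} (hsub : supports G ⊆ S)
    (hdis : ∀ v ∈ S, v ∉ leaves G) (h2 : ∀ v ∉ S, v ∉ leaves G → 2 ≤ degIn G S v) :
    Fintype.card V ≤ (leaves G).ncard + 2 * S.ncard ∧
      (Fintype.card V = (leaves G).ncard + 2 * S.ncard →
        (∀ v ∈ S, degIn G S v = 0) ∧
          ∀ v ∉ S, v ∉ leaves G → degIn G S v = 2 ∧ deg G v = 2) := by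
  -- The right side sums to the total degree $2n$. A leaf contributes 1 + 1, a vertex outside `S`
  -- that is not a leaf at least 2 + 2.
  have hpt : ∀ v ∈ Finset.univ, (if v ∈ leaves G then 2 else if v ∈ S then 0 else 4) ≤
      degIn G S v + (if v ∈ S then 0 else deg G v) := by
    intro v _
    have hle := degIn_le_deg G S v
    by_cases hl : v ∈ leaves G
    · have hvS : v ∉ S := fun h => hdis v h hl
      have hd : deg G v = 1 := hl
      have hin : degIn G S v = 1 := by
        rw [← hd, degIn, Set.inter_eq_left.2, deg]
        exact fun w hw => hsub ⟨v, hl, SimpleGraph.Adj.symm hw⟩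
      simp [hl, hvS, hd, hin]
    · by_cases hvS : v ∈ S
      · simp [hl, hvS]
      · have := h2 v hvS hl
        simp only [hl, hvS, if_false]
        omega
  have hsum := Finset.sum_le_sum hpt
  have heq := Finset.sum_eq_sum_iff_of_le hpt
  have hR : ∑ v, (degIn G S v + if v ∈ S then 0 else deg G v) = 2 * Fintype.card V := by
    rw [Finset.sum_add_distrib, sum_degIn, ← Finset.sum_add_distrib, ← hU.sum_deg]
    exact Finset.sum_congr rfl fun v _ => by by_cases h : v ∈ S <;> simp [h]
  have hL : (∑ v, if v ∈ leaves G then 2 else if v ∈ S then 0 else 4) + 2 * (leaves G).ncard +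
      4 * S.ncard = 4 * Fintype.card V := by
    rw [ncard_eq_sum, ncard_eq_sum, Finset.mul_sum, Finset.mul_sum, ← Finset.sum_add_distrib,
      ← Finset.sum_add_distrib, Finset.sum_congr rfl (g := fun _ => 4)]
    · simp [mul_comm]
    · intro v _
      have := hdis v
      by_cases hl : v ∈ leaves G <;> by_cases hvS : v ∈ S <;> simp_all
  rw [hR] at hsum heq
  refine ⟨by omega, fun hcard => ?_⟩
  have hall := heq.1 (by omega)
  refine ⟨fun v hv => ?_, fun v hv hl => ?_⟩
  · have := hall v (Finset.mem_univ _)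
    simp only [hdis v hv, hv, if_true, if_false] at this
    omega
  · have := hall v (Finset.mem_univ _)
    simp only [hl, hv, if_false] at this
    have := h2 v hv hl
    have := degIn_le_deg G S v
    omega

theorem UniConn.goaNumber_bound (hU : UniConn G) :
    Fintype.card V + (supports G).ncard ≤ 3 * goaNumber G + (leaves G).ncard ∧
      (Fintype.card V + (supports G).ncard = 3 * goaNumber G + (leaves G).ncard →
        Core G (supports G)) := by
  obtain ⟨S, hS, hcard⟩ := exists_isGOA_ncard_eq G
  rw [← hcard]
  have hle := ncard_exchange_le hU hS
  have h2 := fun v => two_le_degIn_exchange hU hS (v := v)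
  have hdis : ∀ v ∈ (S \ leaves G) ∪ supports G, v ∉ leaves G := by
    rintro v (h | h)
    · exact h.2
    · exact hU.notMem_leaves_of_mem_supports h
  have hsub : supports G ⊆ (S \ leaves G) ∪ supports G := Set.subset_union_right
  generalize (S \ leaves G) ∪ supports G = S' at *
  obtain ⟨hb, he⟩ := card_le_of_two_le_degIn hU hsub hdis h2
  have hs : (supports G).ncard ≤ S'.ncard := Set.ncard_le_ncard hsub
  refine ⟨by omega, fun heq => ?_⟩
  -- Equality in the sum of $n\le l+2|S'|$ and $s\le|S'|$ forces equality in both.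
  obtain rfl : supports G = S' := Set.eq_of_subset_of_ncard_le hsub (by omega)
  obtain ⟨h0, h22⟩ := he (by omega)
  have hin : ∀ v ∉ supports G, ∀ w, G.Adj v w → w ∈ supports G := by
    intro v hv w hw
    by_cases hl : v ∈ leaves G
    · exact ⟨v, hl, hw.symm⟩
    · obtain ⟨ha, hb⟩ := h22 v hv hl
      have : G.neighborSet v ∩ supports G = G.neighborSet v :=
        Set.eq_of_subset_of_ncard_le Set.inter_subset_left (by
          change deg G v ≤ degIn G _ v
          omega)
      exact Set.inter_eq_left.1 this hw
  refine ⟨fun x y hxy => ⟨fun hx hy => ?_, fun hy => hin y hy x hxy.symm⟩, ?_, fun v hv => ?_⟩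
  · have : G.neighborSet x ∩ supports G = ∅ := (Set.ncard_eq_zero).1 (h0 x hx)
    exact Set.eq_empty_iff_forall_notMem.1 this y ⟨hxy, hy⟩
  · rintro x ⟨u, hu, ha⟩
    exact ⟨u, ha, hu⟩
  · by_cases hl : v ∈ leaves G
    · exact Or.inl hl
    · exact Or.inr (h22 v hv hl).2

/-- A leaf in `A` would be adjacent to another leaf, which is impossible here; so the neighbor of a
leaf lies in `A`. -/
theorem Core.eq_supports (hU : UniConn G) {A : Set V} (hA : Core G A) : A = supports G := by
  refine Set.Subset.antisymm ?_ ?_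
  · intro x hx
    obtain ⟨u, ha, hu⟩ := hA.leaf hx
    exact ⟨u, hu, ha⟩
  · rintro x ⟨u, hu, ha⟩
    rw [hA.bip ha]
    intro hu'
    obtain ⟨w, hw, hd⟩ := hA.leaf hu'
    exact hU.deg_ne_one_of_adj hw hu hd

theorem Core.degIn_eq {A : Set V} (hA : Core G A) (v : V) :
    degIn G A v = if v ∈ A then 0 else deg G v := by
  rw [degIn, deg]
  by_cases hv : v ∈ A
  · rw [if_pos hv, Set.ncard_eq_zero, Set.eq_empty_iff_forall_notMem]
    exact fun w hw => (hA.bip hw.1).1 hv hw.2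
  · rw [if_neg hv, Set.inter_eq_left.2]
    exact fun w hw => by_contra fun h => hv ((hA.bip hw).2 h)

theorem Core.notMem_of_leaf (hU : UniConn G) {A : Set V} (hA : Core G A) {v : V}
    (hv : deg G v = 1) : v ∉ A := by
  intro h
  obtain ⟨w, hw, hd⟩ := hA.leaf h
  exact hU.deg_ne_one_of_adj hw hv hd

/-- Every edge has exactly one end in `A`, so the sum counts the edges. -/
theorem Core.sum_deg_eq_card (hU : UniConn G) {A : Set V} (hA : Core G A) :
    (∑ v, if v ∈ A then deg G v else 0) = Fintype.card V := by
  have h1 := sum_degIn G A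
  simp_rw [hA.degIn_eq] at h1
  have h2 : (∑ v, if v ∈ A then 0 else deg G v) + (∑ v, if v ∈ A then deg G v else 0) =
      ∑ v, deg G v := by
    rw [← Finset.sum_add_distrib]
    exact Finset.sum_congr rfl fun v _ => by by_cases h : v ∈ A <;> simp [h]
  have := hU.sum_deg
  omega

/-- The degrees outside `A` also sum to $n$; they are 1 at leaves and 2 elsewhere, so
$l+2(n-|A|-l)=n$. -/
theorem Core.card_eq (hU : UniConn G) {A : Set V} (hA : Core G A) :
    Fintype.card V = (leaves G).ncard + 2 * A.ncard := by
  have h1 := sum_degIn G A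
  rw [hA.sum_deg_eq_card hU] at h1
  simp_rw [hA.degIn_eq] at h1
  have h2 : (∑ v, if v ∈ A then 0 else deg G v) + (leaves G).ncard + 2 * A.ncard =
      2 * Fintype.card V := by
    rw [ncard_eq_sum, ncard_eq_sum, Finset.mul_sum, ← Finset.sum_add_distrib,
      ← Finset.sum_add_distrib, Finset.sum_congr rfl (g := fun _ => 2)]
    · simp [mul_comm]
    · intro v _
      have hlow := hA.low (x := v)
      have hn := hA.notMem_of_leaf hU (v := v)
      rw [mem_leaves_iff]
      by_cases hvA : v ∈ A
      · simpa [hvA] using fun h => hn h hvA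
      · rcases hlow hvA with h | h <;> simp [hvA, h]
  omega

theorem Core.isGOA (hU : UniConn G) {A : Set V} (hA : Core G A) : IsGOA G A := by
  refine ⟨fun v hv => ?_, fun v hv => ?_⟩
  · obtain ⟨w, hw⟩ := (Set.ncard_pos).1 (hU.deg_pos v)
    exact ⟨w, by_contra fun h => hv ((hA.bip hw).2 h), hw⟩
  · have h1 := closedNbhd_diff (G := G) hv
    have h2 := closedNbhd_inter (G := G) hv
    have h3 := hA.degIn_eq v
    rw [if_neg hv] at h3
    have := hU.deg_pos v
    omega

theorem goaNumber_eq_iff_exists_core (hU : UniConn G) :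
    (goaNumber G : ℚ) =
        ((Fintype.card V : ℚ) - (leaves G).ncard + (supports G).ncard) / 3 ↔
      ∃ A, Core G A := by
  have hq : (goaNumber G : ℚ) =
        ((Fintype.card V : ℚ) - (leaves G).ncard + (supports G).ncard) / 3 ↔
      Fintype.card V + (supports G).ncard = 3 * goaNumber G + (leaves G).ncard := by
    rw [eq_div_iff (by norm_num), ← @Nat.cast_inj ℚ]
    push_cast
    constructor <;> intro h <;> linarith
  rw [hq]
  refine ⟨fun h => ⟨_, hU.goaNumber_bound.2 h⟩, fun ⟨A, hA⟩ => ?_⟩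
  obtain rfl := hA.eq_supports hU
  have h1 := hA.card_eq hU
  have h2 := goaNumber_le (hA.isGOA hU)
  have h3 := hU.goaNumber_bound.1
  omega

end Bounds


/-! ### Attaching a graph by one edge -/

section Attach

open scoped Classical

variable {V W : Type*} {G : SimpleGraph V} {P : SimpleGraph W} {v : V} {a : W}

theorem neighborSet_attach_inl (x : V) : (attach G v P a).neighborSet (.inl x) =
    Sum.inl '' G.neighborSet x ∪ (if x = v then {.inr a} else ∅) := by
  ext (y | y)
  · by_cases h : x = v <;> simp [attach, h]
  · by_cases h : x = v <;> simp [attach, h]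

theorem neighborSet_attach_inr (x : W) : (attach G v P a).neighborSet (.inr x) =
    Sum.inr '' P.neighborSet x ∪ (if x = a then {.inl v} else ∅) := by
  ext (y | y)
  · by_cases h : x = a <;> simp [attach, h]
  · by_cases h : x = a <;> simp [attach, h]

theorem deg_attach_inl_of_ne {x : V} (hx : x ≠ v) : deg (attach G v P a) (.inl x) = deg G x := by
  rw [deg, neighborSet_attach_inl, if_neg hx, Set.union_empty,
    Set.ncard_image_of_injective _ Sum.inl_injective, deg]

theorem deg_attach_inr_of_ne {x : W} (hx : x ≠ a) : deg (attach G v P a) (.inr x) = deg P x := by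
  rw [deg, neighborSet_attach_inr, if_neg hx, Set.union_empty,
    Set.ncard_image_of_injective _ Sum.inr_injective, deg]

theorem deg_attach_inl_self [Finite V] : deg (attach G v P a) (.inl v) = deg G v + 1 := by
  rw [deg, neighborSet_attach_inl, if_pos rfl, Set.union_singleton,
    Set.ncard_insert_of_notMem (by simp) (Set.toFinite _),
    Set.ncard_image_of_injective _ Sum.inl_injective, deg]

theorem deg_attach_inr_self [Finite W] : deg (attach G v P a) (.inr a) = deg P a + 1 := by
  rw [deg, neighborSet_attach_inr, if_pos rfl, Set.union_singleton,
    Set.ncard_insert_of_notMem (by simp) (Set.toFinite _),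
    Set.ncard_image_of_injective _ Sum.inr_injective, deg]

theorem sum_deg_attach [Fintype V] [Fintype W] :
    ∑ x, deg (attach G v P a) x = ∑ x, deg G x + ∑ x, deg P x + 2 := by
  have h1 : ∀ x, deg (attach G v P a) (.inl x) = deg G x + if x = v then 1 else 0 := fun x => by
    by_cases h : x = v
    · subst h; simp [deg_attach_inl_self]
    · simp [h, deg_attach_inl_of_ne]
  have h2 : ∀ x, deg (attach G v P a) (.inr x) = deg P x + if x = a then 1 else 0 := fun x => by
    by_cases h : x = a
    · subst h; simp [deg_attach_inr_self]
    · simp [h, deg_attach_inr_of_ne]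
  simp_rw [Fintype.sum_sum_type, h1, h2, Finset.sum_add_distrib]
  simp
  ring

/-- Collapsing `P` to `v` sends walks to walks, up to stationary steps. -/
theorem connected_of_connected_attach (h : (attach G v P a).Connected) : G.Connected := by
  have key : ∀ x y, (attach G v P a).Reachable x y →
      G.Reachable (Sum.elim id (fun _ => v) x) (Sum.elim id (fun _ => v) y) := by
    rintro x y ⟨p⟩
    induction p with
    | nil => rfl
    | cons hadj _ ih =>
      refine SimpleGraph.Reachable.trans ?_ ih
      rename_i x y _ _
      rcases x with x | x <;> rcases y with y | y
      · exact SimpleGraph.Adj.reachable hadj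
      · obtain ⟨rfl, rfl⟩ := hadj; rfl
      · obtain ⟨rfl, rfl⟩ := hadj; rfl
      · rfl
  have : Nonempty V := ⟨v⟩
  exact ⟨fun x y => key _ _ (h.preconnected (.inl x) (.inl y))⟩

theorem uniConn_of_uniConn_attach [Fintype V] [Fintype W]
    (hP : ∑ x, deg P x + 2 = 2 * Fintype.card W) (h : UniConn (attach G v P a)) : UniConn G := by
  refine ⟨connected_of_connected_attach h.conn, ?_⟩
  have := h.sum_deg
  rw [sum_deg_attach, Fintype.card_sum] at this
  omega

/-- Only `v` loses a neighbor when `P` is removed, so `hl` is needed to leave it a leaf. -/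
theorem core_of_core_attach {A : Set (V ⊕ W)} (h : Core (attach G v P a) A) (hv : .inl v ∈ A)
    (hl : ∃ u, G.Adj v u ∧ deg G u = 1) : Core G (Sum.inl ⁻¹' A) := by
  refine ⟨fun x y hxy => h.bip (x := .inl x) (y := .inl y) hxy, fun x hx => ?_, fun x hx => ?_⟩
  · by_cases hxv : x = v
    · exact hxv ▸ hl
    · obtain ⟨u | u, hu, hd⟩ := h.leaf hx
      · refine ⟨u, hu, ?_⟩
        rw [← hd, deg_attach_inl_of_ne]
        rintro rfl
        exact ((h.bip (x := .inl x) (y := .inl u) hu).1 hx) hv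
      · exact absurd hu.1 hxv
  · rw [← deg_attach_inl_of_ne (G := G) (v := v) (P := P) (a := a)
      (by rintro rfl; exact hx hv)]
    exact h.low hx

theorem deg_pathGraph_one : deg (SimpleGraph.pathGraph 1) 0 = 0 := by
  have h : (SimpleGraph.pathGraph 1).neighborSet 0 = ∅ := by
    ext x
    simp [Subsingleton.elim x 0]
  rw [deg, h, Set.ncard_empty]

theorem deg_pathGraph_three :
    deg (SimpleGraph.pathGraph 3) 0 = 1 ∧ deg (SimpleGraph.pathGraph 3) 1 = 2 ∧
      deg (SimpleGraph.pathGraph 3) 2 = 1 := by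
  have h0 : (SimpleGraph.pathGraph 3).neighborSet 0 = {1} := by
    ext x; fin_cases x <;> simp [SimpleGraph.pathGraph_adj]
  have h1 : (SimpleGraph.pathGraph 3).neighborSet 1 = {0, 2} := by
    ext x; fin_cases x <;> simp [SimpleGraph.pathGraph_adj]
  have h2 : (SimpleGraph.pathGraph 3).neighborSet 2 = {1} := by
    ext x; fin_cases x <;> simp [SimpleGraph.pathGraph_adj]
  simp [deg, h0, h1, h2]

/-- The bipartition extends over an attached vertex. -/
theorem Core.attach_one {A : Set V} (h : Core G A) (hv : v ∈ A) :
    Core (attach G v (SimpleGraph.pathGraph 1) 0) (Sum.inl '' A) := by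
  have hne : ∀ {u}, u ∉ A → deg (attach G v (SimpleGraph.pathGraph 1) 0) (.inl u) = deg G u :=
    fun hu => deg_attach_inl_of_ne (by rintro rfl; exact hu hv)
  have hd : deg (attach G v (SimpleGraph.pathGraph 1) 0) (.inr 0) = 1 := by
    rw [deg_attach_inr_self, deg_pathGraph_one]
  refine ⟨?_, ?_, ?_⟩
  · rintro (x | x) (y | y) hxy
    · simpa using h.bip hxy
    · simpa [hxy.1] using hv
    · simpa [hxy.1] using hv
    · rw [Subsingleton.elim x y] at hxy
      exact absurd hxy (SimpleGraph.irrefl _)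
  · rintro _ ⟨x, hx, rfl⟩
    obtain ⟨u, hu, hd⟩ := h.leaf hx
    exact ⟨.inl u, hu, by rw [hne ((h.bip hu).1 hx), hd]⟩
  · rintro (x | x) hx
    · have hx : x ∉ A := by simpa using hx
      rw [hne hx]
      exact h.low hx
    · rw [Subsingleton.elim x 0]
      exact Or.inl hd

/-- The bipartition extends over an attached path on three vertices. -/
theorem Core.attach_three {A : Set V} (h : Core G A) (hv : v ∈ A) :
    Core (attach G v (SimpleGraph.pathGraph 3) 0) (Sum.inl '' A ∪ {.inr 1}) := by
  have hne : ∀ {u}, u ∉ A → deg (attach G v (SimpleGraph.pathGraph 3) 0) (.inl u) = deg G u :=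
    fun hu => deg_attach_inl_of_ne (by rintro rfl; exact hu hv)
  obtain ⟨h0, h1, h2⟩ := deg_pathGraph_three
  refine ⟨?_, ?_, ?_⟩
  · rintro (x | x) (y | y) hxy
    · simpa using h.bip hxy
    · simpa [hxy.1, hxy.2] using hv
    · simpa [hxy.1, hxy.2] using hv
    · have hxy : (SimpleGraph.pathGraph 3).Adj x y := hxy
      fin_cases x <;> fin_cases y <;> simp [SimpleGraph.pathGraph_adj] at hxy ⊢
  · rintro _ (⟨x, hx, rfl⟩ | rfl)
    · obtain ⟨u, hu, hd⟩ := h.leaf hx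
      exact ⟨.inl u, hu, by rw [hne ((h.bip hu).1 hx), hd]⟩
    · refine ⟨.inr 2, ?_, by rw [deg_attach_inr_of_ne (by decide), h2]⟩
      change (SimpleGraph.pathGraph 3).Adj 1 2
      simp [SimpleGraph.pathGraph_adj]
  · rintro (x | x) hx
    · have hx : x ∉ A := by simpa using hx
      rw [hne hx]
      exact h.low hx
    · fin_cases x
      · right
        change deg (attach G v (SimpleGraph.pathGraph 3) 0) (.inr 0) = 2
        rw [deg_attach_inr_self, h0]
      · simp at hx
      · left
        change deg (attach G v (SimpleGraph.pathGraph 3) 0) (.inr 2) = 1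
        rw [deg_attach_inr_of_ne (by decide), h2]

end Attach

/-! ### The base graphs have a core -/

section Base

open scoped Classical

variable {m : ℕ}

/-- A form without modular subtraction, suited to `omega`. The inequality matters only for `n = 1`,
where 0 is both first and last. -/
theorem cycleGraph_adj_iff {n : ℕ} {a b : Fin n} : (SimpleGraph.cycleGraph n).Adj a b ↔
    a.val ≠ b.val ∧ (a.val + 1 = b.val ∨ b.val + 1 = a.val ∨ (a.val = 0 ∧ b.val + 1 = n) ∨
      (b.val = 0 ∧ a.val + 1 = n)) := by
  rw [SimpleGraph.cycleGraph_adj']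
  have ha := a.2
  have hb := b.2
  rcases lt_trichotomy a b with h | h | h
  · rw [Fin.coe_sub_iff_lt.2 h, Fin.coe_sub_iff_le.2 h.le]
    have : a.val < b.val := h
    omega
  · subst h
    rw [Fin.coe_sub_iff_le.2 le_rfl]
    omega
  · rw [Fin.coe_sub_iff_lt.2 h, Fin.coe_sub_iff_le.2 h.le]
    have : b.val < a.val := h
    omega

theorem deg_cycleGraph {n : ℕ} (hn : 3 ≤ n) (a : Fin n) :
    deg (SimpleGraph.cycleGraph n) a = 2 := by
  obtain ⟨n, rfl⟩ := Nat.exists_eq_add_of_le' hn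
  rw [deg_eq_degree, ← SimpleGraph.cycleGraph_degree_three_le (v := a)]
  congr!

theorem deg_baseGraph_inr (i : Fin m) : deg (baseGraph m) (.inr i) = 1 := by
  have h : (baseGraph m).neighborSet (.inr i) = {.inl ⟨2 * i.val, by omega⟩} := by
    ext (x | x) <;> simp [baseGraph, Fin.ext_iff]
  rw [deg, h, Set.ncard_singleton]

theorem deg_baseGraph_odd (hm : 2 ≤ m) (a : Fin (2 * m)) (ha : Odd a.val) :
    deg (baseGraph m) (.inl a) = 2 := by
  have h : (baseGraph m).neighborSet (.inl a) =
      Sum.inl '' (SimpleGraph.cycleGraph (2 * m)).neighborSet a := by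
    ext (x | x)
    · simp [baseGraph]
    · simp only [baseGraph, SimpleGraph.mem_neighborSet, Set.mem_image, reduceCtorEq, and_false,
        exists_false, iff_false]
      intro h
      exact Nat.not_even_iff_odd.2 ha (by rw [h]; exact even_two_mul _)
  rw [deg, h, Set.ncard_image_of_injective _ Sum.inl_injective]
  exact deg_cycleGraph (by omega) a

theorem deg_baseGraph_even (hm : 2 ≤ m) (a : Fin (2 * m)) (ha : Even a.val) :
    deg (baseGraph m) (.inl a) = 3 := by
  have h : (baseGraph m).neighborSet (.inl a) =
      insert (.inr ⟨a.val / 2, by omega⟩)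
        (Sum.inl '' (SimpleGraph.cycleGraph (2 * m)).neighborSet a) := by
    obtain ⟨k, hk⟩ := ha
    ext (x | x)
    · simp [baseGraph]
    · simp only [baseGraph, SimpleGraph.mem_neighborSet, Set.mem_insert_iff, Set.mem_image,
        reduceCtorEq, and_false, exists_false, or_false, Sum.inr.injEq, Fin.ext_iff]
      omega
  rw [deg, h, Set.ncard_insert_of_notMem (by simp),
    Set.ncard_image_of_injective _ Sum.inl_injective]
  exact congrArg (· + 1) (deg_cycleGraph (by omega) a)

theorem core_baseGraph (hm : 2 ≤ m) :
    Core (baseGraph m) (Sum.inl '' {a : Fin (2 * m) | Even a.val}) := by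
  refine ⟨?_, ?_, ?_⟩
  · rintro (x | x) (y | y) hxy
    · have hxy : (SimpleGraph.cycleGraph (2 * m)).Adj x y := hxy
      rw [cycleGraph_adj_iff] at hxy
      simp [Nat.even_iff]
      omega
    · have hxy : x.val = 2 * y.val := hxy
      simp [hxy]
    · have hxy : y.val = 2 * x.val := hxy
      simp [hxy]
    · exact hxy.elim
  · rintro _ ⟨a, ha, rfl⟩
    obtain ⟨k, hk⟩ := ha
    refine ⟨.inr ⟨k, by omega⟩, ?_, deg_baseGraph_inr _⟩
    change a.val = 2 * k
    omega
  · rintro (x | x) hx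
    · exact Or.inr (deg_baseGraph_odd hm x (by simpa using hx))
    · exact Or.inl (deg_baseGraph_inr x)

end Base

/-! ### Every member of the family has a core -/

section Family

universe u

theorem deg_ne_one_of_adj_of_adj {V : Type*} {G : SimpleGraph V} {v b c : V} (hb : G.Adj v b)
    (hc : G.Adj v c) (hbc : b ≠ c) : deg G v ≠ 1 :=
  fun h => hbc (eq_of_deg_eq_one h hb hc)

theorem Core.mem_of_mem_supports {V : Type u} {G : SimpleGraph V} {A : Set V} (h : Core G A)
    (h2 : ∀ x ∈ A, ∃ b c, b ≠ c ∧ G.Adj x b ∧ G.Adj x c) {v : V} (hv : v ∈ supports G) :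
    v ∈ A := by
  obtain ⟨u, hu, ha⟩ := hv
  refine (h.bip ha).2 fun hA => ?_
  obtain ⟨b, c, hbc, hb, hc⟩ := h2 u hA
  exact deg_ne_one_of_adj_of_adj hb hc hbc hu

theorem exists_two_adj_iso {V W : Type*} {G : SimpleGraph V} {H : SimpleGraph W} (e : G ≃g H)
    {A : Set V} (h2 : ∀ x ∈ A, ∃ b c, b ≠ c ∧ G.Adj x b ∧ G.Adj x c) :
    ∀ x ∈ e.symm ⁻¹' A, ∃ b c, b ≠ c ∧ H.Adj x b ∧ H.Adj x c := by
  intro x hx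
  obtain ⟨b, c, hbc, hb, hc⟩ := h2 _ hx
  refine ⟨e b, e c, e.injective.ne hbc, ?_, ?_⟩
  · simpa using e.map_adj_iff.2 hb
  · simpa using e.map_adj_iff.2 hc

/-- The two neighbors are carried through the induction so that no vertex of `A` is a leaf; hence
the support vertex used by an operation lies in `A`. -/
theorem Family.exists_core {V : Type u} {G : SimpleGraph V} (h : Family G) :
    ∃ A, Core G A ∧ ∀ x ∈ A, ∃ b c, b ≠ c ∧ G.Adj x b ∧ G.Adj x c := by
  induction h with
  | base m hm e =>
    refine ⟨_, (core_baseGraph hm).iso e, exists_two_adj_iso e ?_⟩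
    rintro _ ⟨a, ha, rfl⟩
    obtain ⟨k, hk⟩ := ha
    refine ⟨.inr ⟨k, by omega⟩, .inl ⟨a.val + 1, by omega⟩, by simp, ?_, ?_⟩
    · change a.val = 2 * k
      omega
    · change (SimpleGraph.cycleGraph (2 * m)).Adj _ _
      rw [cycleGraph_adj_iff]
      simp
  | @opO1 V W G H hG v hv e ih =>
    obtain ⟨A, hA, h2⟩ := ih
    have hvA := hA.mem_of_mem_supports h2 hv
    refine ⟨_, (hA.attach_one hvA).iso e, exists_two_adj_iso e ?_⟩
    rintro _ ⟨x, hx, rfl⟩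
    obtain ⟨b, c, hbc, hb, hc⟩ := h2 x hx
    exact ⟨.inl b, .inl c, by simpa using hbc, hb, hc⟩
  | @opO2 V W G H hG v hv e ih =>
    obtain ⟨A, hA, h2⟩ := ih
    have hvA := hA.mem_of_mem_supports h2 hv
    refine ⟨_, (hA.attach_three hvA).iso e, exists_two_adj_iso e ?_⟩
    rintro _ (⟨x, hx, rfl⟩ | rfl)
    · obtain ⟨b, c, hbc, hb, hc⟩ := h2 x hx
      exact ⟨.inl b, .inl c, by simpa using hbc, hb, hc⟩
    · have h10 : (SimpleGraph.pathGraph 3).Adj 1 0 := by simp [SimpleGraph.pathGraph_adj]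
      have h12 : (SimpleGraph.pathGraph 3).Adj 1 2 := by simp [SimpleGraph.pathGraph_adj]
      exact ⟨.inr 0, .inr 2, by simp, h10, h12⟩

end Family


/-! ### Undoing the two operations -/

section Reduction

open scoped Classical

universe u

variable {V W : Type*} {G : SimpleGraph V} {P : SimpleGraph W}

/-- An induced subgraph that is joined to the remaining vertices by one edge only is attached. -/
noncomputable def attachIso (f : P ↪g G) (v : ↥(Set.range f)ᶜ) (a : W)
    (h : ∀ x ∉ Set.range f, ∀ i, G.Adj x (f i) ↔ x = v ∧ i = a) :
    attach (G.induce (Set.range f)ᶜ) v P a ≃g G where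
  toEquiv := Equiv.ofBijective (Sum.elim Subtype.val f) <| by
    refine ⟨?_, fun x => ?_⟩
    · rintro (x | x) (y | y) hxy
      · exact congrArg _ (Subtype.ext hxy)
      · exact absurd ⟨y, hxy.symm⟩ x.2
      · exact absurd ⟨x, hxy⟩ y.2
      · exact congrArg _ (f.injective hxy)
    · by_cases hx : x ∈ Set.range f
      · obtain ⟨i, rfl⟩ := hx
        exact ⟨.inr i, rfl⟩
      · exact ⟨.inl ⟨x, hx⟩, rfl⟩
  map_rel_iff' := by
    rintro (x | x) (y | y)
    · exact Iff.rfl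
    · exact (h x x.2 y).trans (and_congr_left' Subtype.ext_iff.symm)
    · exact (G.adj_comm _ _).trans ((h y y.2 x).trans (and_congr_left' Subtype.ext_iff.symm))
    · exact f.map_adj_iff

theorem attachIso_inl (f : P ↪g G) (v : ↥(Set.range f)ᶜ) (a : W)
    (h : ∀ x ∉ Set.range f, ∀ i, G.Adj x (f i) ↔ x = v ∧ i = a) (x : ↥(Set.range f)ᶜ) :
    attachIso f v a h (.inl x) = x := rfl

/-- The common inductive step. `hP` says that `P` has one edge fewer than vertices, and the leaf
outside `P` keeps `v` a support vertex. -/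
theorem reduction [Fintype V] [Fintype W] (f : P ↪g G) (v : ↥(Set.range f)ᶜ) (a : W)
    (h : ∀ x ∉ Set.range f, ∀ i, G.Adj x (f i) ↔ x = v ∧ i = a)
    (hP : ∑ x, deg P x + 2 = 2 * Fintype.card W) (hU : UniConn G) {A : Set V} (hA : Core G A)
    (hv : ↑v ∈ A) (hl : ∃ u ∉ Set.range f, G.Adj v u ∧ deg G u = 1) :
    UniConn (G.induce (Set.range f)ᶜ) ∧ (∃ B, Core (G.induce (Set.range f)ᶜ) B) ∧
      v ∈ supports (G.induce (Set.range f)ᶜ) := by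
  obtain ⟨u, hur, hadj, hd⟩ := hl
  have hu : deg (G.induce (Set.range f)ᶜ) ⟨u, hur⟩ = 1 := by
    rw [← deg_attach_inl_of_ne (v := v) (P := P) (a := a), ← deg_iso (attachIso f v a h),
      attachIso_inl, hd]
    rintro rfl
    exact SimpleGraph.irrefl _ hadj
  refine ⟨uniConn_of_uniConn_attach hP (hU.iso (attachIso f v a h).symm),
    ⟨_, core_of_core_attach (hA.iso (attachIso f v a h).symm) hv ⟨⟨u, hur⟩, hadj, hu⟩⟩,
    ⟨⟨u, hur⟩, hu, hadj⟩⟩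

theorem exists_ne_of_deg_eq_two {v a : V} (h : deg G v = 2) : ∃ b, b ≠ a ∧ G.Adj v b := by
  obtain ⟨x, y, hxy, hN⟩ := Set.ncard_eq_two.1 h
  have hx : x ∈ G.neighborSet v := by simp [hN]
  have hy : y ∈ G.neighborSet v := by simp [hN]
  by_cases hxa : x = a
  · exact ⟨y, fun hy => hxy (hxa.trans hy.symm), hy⟩
  · exact ⟨x, hxa, hx⟩

theorem eq_or_eq_of_deg_eq_two {v a b c : V} (h : deg G v = 2) (ha : G.Adj v a) (hb : G.Adj v b)
    (hab : a ≠ b) (hc : G.Adj v c) : c = a ∨ c = b := by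
  obtain ⟨x, y, hxy, hN⟩ := Set.ncard_eq_two.1 h
  have ha : a ∈ G.neighborSet v := ha
  have hb : b ∈ G.neighborSet v := hb
  have hc : c ∈ G.neighborSet v := hc
  rw [hN] at ha hb hc
  simp only [Set.mem_insert_iff, Set.mem_singleton_iff] at ha hb hc
  grind

/-- Removal of one of two leaves with the same neighbor. -/
theorem family_of_two_leaves {V : Type u} [Fintype V] {G : SimpleGraph V} (hU : UniConn G)
    {A : Set V} (hA : Core G A) {v u x : V} (hv : v ∈ A) (hux : u ≠ x) (hu : G.Adj v u)
    (hx : G.Adj v x) (hdu : deg G u = 1) (hdx : deg G x = 1)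
    (ih : ∀ (S : Set V) [Fintype S], Fintype.card S < Fintype.card V → UniConn (G.induce S) →
      (∃ B, Core (G.induce S) B) → Family (G.induce S)) : Family G := by
  let f : SimpleGraph.pathGraph 1 ↪g G :=
    ⟨⟨fun _ => x, fun i j _ => Subsingleton.elim i j⟩, by
      intro i j
      rw [Subsingleton.elim i j]
      simp⟩
  have hf : ∀ y, y ∈ Set.range f ↔ y = x := fun y =>
    ⟨fun ⟨_, h⟩ => h.symm, fun h => ⟨0, h.symm⟩⟩
  have hvr : v ∉ Set.range f := by rw [hf]; exact hx.ne
  have hadj : ∀ y ∉ Set.range f, ∀ i, G.Adj y (f i) ↔ y = v ∧ i = 0 := by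
    refine fun y _ i => ⟨fun h => ⟨?_, Subsingleton.elim _ _⟩, fun h => h.1 ▸ hx⟩
    exact eq_of_deg_eq_one hdx h.symm hx.symm
  obtain ⟨hU', hA', hs⟩ := reduction f ⟨v, hvr⟩ 0 hadj (by simp [deg_pathGraph_one]) hU hA hv
    ⟨u, by rwa [hf], hu, hdu⟩
  refine Family.opO1 (ih _ ?_ hU' hA') ⟨v, hvr⟩ hs (attachIso f ⟨v, hvr⟩ 0 hadj)
  exact Fintype.card_subtype_lt (x := x) (by simp [hf])

/-- Removal of a path of three vertices that ends in a support vertex of degree two and its leaf. -/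
theorem family_of_pendant_path {V : Type u} [Fintype V] {G : SimpleGraph V} (hU : UniConn G)
    {A : Set V} (hA : Core G A) {b c : V} (hb : b ∈ A) (hbc : G.Adj b c) (hdb : deg G b = 2)
    (hdc : deg G c = 1) (huniq : ∀ x, G.Adj b x → deg G x = 1 → x = c)
    (ih : ∀ (S : Set V) [Fintype S], Fintype.card S < Fintype.card V → UniConn (G.induce S) →
      (∃ B, Core (G.induce S) B) → Family (G.induce S)) : Family G := by
  obtain ⟨a, hac, hba⟩ := exists_ne_of_deg_eq_two (a := c) hdb
  have haA : a ∉ A := (hA.bip hba).1 hb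
  -- The other neighbor `a` of `b` is not a leaf, so the path continues to a vertex `v` of `A`.
  have hda : deg G a = 2 := (hA.low haA).resolve_left fun h => hac (huniq a hba h)
  obtain ⟨v, hvb, hav⟩ := exists_ne_of_deg_eq_two (a := b) hda
  have hvA : v ∈ A := by_contra fun h => haA ((hA.bip hav).2 h)
  have hnac : ¬ G.Adj a c := fun h => hba.ne (eq_of_deg_eq_one hdc hbc.symm h.symm)
  have hcx : ∀ x, G.Adj c x → x = b := fun x hx => eq_of_deg_eq_one hdc hx hbc.symm
  have hbx : ∀ x, G.Adj b x → x = a ∨ x = c :=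
    fun x hx => eq_or_eq_of_deg_eq_two hdb hba hbc hac hx
  have hax : ∀ x, G.Adj a x → x = b ∨ x = v :=
    fun x hx => eq_or_eq_of_deg_eq_two hda hba.symm hav hvb.symm hx
  let f : SimpleGraph.pathGraph 3 ↪g G :=
    ⟨⟨![a, b, c], by
      have h1 := hba.ne
      have h2 := hbc.ne
      intro i j hij
      fin_cases i <;> fin_cases j <;> simp_all⟩, by
      intro i j
      change G.Adj (![a, b, c] i) (![a, b, c] j) ↔ _
      fin_cases i <;> fin_cases j <;>
        simp [SimpleGraph.pathGraph_adj, hba, hbc, hba.symm, hbc.symm, hnac, G.adj_comm c a]⟩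
  have hf : ∀ y, y ∈ Set.range f ↔ y = a ∨ y = b ∨ y = c := by
    intro y
    change y ∈ Set.range ![a, b, c] ↔ _
    simp only [Set.mem_range, Fin.exists_fin_succ, Fin.exists_fin_zero]
    simp [eq_comm]
  have hvr : v ∉ Set.range f := by
    rw [hf]
    rintro (rfl | rfl | rfl)
    · exact SimpleGraph.irrefl _ hav
    · exact hvb rfl
    · exact hnac hav
  have hadj : ∀ y ∉ Set.range f, ∀ i, G.Adj y (f i) ↔ y = v ∧ i = 0 := by
    intro y hy i
    rw [hf] at hy
    push Not at hy
    obtain ⟨h1, h2, h3⟩ := hy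
    fin_cases i
    · change G.Adj y a ↔ y = v ∧ (0 : Fin 3) = 0
      refine ⟨fun h => ⟨(hax y h.symm).resolve_left h2, rfl⟩, fun h => h.1 ▸ hav.symm⟩
    · change G.Adj y b ↔ y = v ∧ (1 : Fin 3) = 0
      refine ⟨fun h => ?_, fun h => absurd h.2 (by decide)⟩
      rcases hbx y h.symm with h | h <;> contradiction
    · change G.Adj y c ↔ y = v ∧ (2 : Fin 3) = 0
      exact ⟨fun h => absurd (hcx y h.symm) h2, fun h => absurd h.2 (by decide)⟩
  -- The leaf of `v` avoids the path: `a` and `b` have degree two, and `c` is adjacent only to `b`.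
  have hl : ∃ u ∉ Set.range f, G.Adj v u ∧ deg G u = 1 := by
    obtain ⟨u, hu, hd⟩ := hA.leaf hvA
    refine ⟨u, ?_, hu, hd⟩
    rw [hf]
    rintro (rfl | rfl | rfl)
    · omega
    · omega
    · exact hvb (hcx v hu.symm)
  obtain ⟨h0, h1, h2⟩ := deg_pathGraph_three
  obtain ⟨hU', hA', hs⟩ := reduction f ⟨v, hvr⟩ 0 hadj
    (by rw [Fin.sum_univ_three, h0, h1, h2]; simp) hU hA hvA hl
  refine Family.opO2 (ih _ ?_ hU' hA') ⟨v, hvr⟩ hs (attachIso f ⟨v, hvr⟩ 0 hadj)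
  exact Fintype.card_subtype_lt (x := c) (by simp [hf])

end Reduction

/-! ### Irreducible graphs and the final induction -/

section BaseCase

open scoped Classical

variable {V W : Type*} {G : SimpleGraph V}

/-- The degree bound makes `F` bijective on neighborhoods, so its image is closed under adjacency
and is everything by connectedness. -/
theorem nonempty_iso_of_injective [Finite V] [Nonempty W] {H : SimpleGraph W} (F : H →g G)
    (hF : Function.Injective F) (hG : G.Connected) (hd : ∀ x, deg G (F x) ≤ deg H x) :
    Nonempty (H ≃g G) := by
  have hN : ∀ x, F '' H.neighborSet x = G.neighborSet (F x) := by
    intro x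
    refine Set.eq_of_subset_of_ncard_le ?_ ?_ (Set.toFinite _)
    · rintro _ ⟨y, hy, rfl⟩
      exact F.map_adj hy
    · rw [Set.ncard_image_of_injective _ hF]
      exact hd x
  have hsurj : ∀ y, y ∈ Set.range F := by
    refine mem_of_connected_of_closed hG (x := F (Classical.arbitrary W)) ⟨_, rfl⟩ ?_
    rintro _ ⟨x, rfl⟩ y hy
    have hy : y ∈ G.neighborSet (F x) := hy
    rw [← hN] at hy
    obtain ⟨z, _, rfl⟩ := hy
    exact ⟨z, rfl⟩
  refine ⟨⟨Equiv.ofBijective F ⟨hF, hsurj⟩, fun {x y} => ⟨fun h => ?_, fun h => F.map_adj h⟩⟩⟩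
  have h : F y ∈ G.neighborSet (F x) := h
  rw [← hN, hF.mem_set_image] at h
  exact h

/-- By `h1`, $l\le|A|$. The degrees in `A` are at least 3 and sum to $n=l+2|A|\le3|A|$, so each
equals 3. -/
theorem Core.deg_eq_three [Fintype V] (hU : UniConn G) {A : Set V} (hA : Core G A)
    (h1 : ∀ v ∈ A, ∀ u x, G.Adj v u → G.Adj v x → deg G u = 1 → deg G x = 1 → u = x)
    (h2 : ∀ v ∈ A, deg G v ≠ 2) : ∀ v ∈ A, deg G v = 3 := by
  have h3 : ∀ v ∈ A, 3 ≤ deg G v := fun v hv => by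
    have h4 := hU.deg_pos v
    have h5 := h2 v hv
    have h6 : deg G v ≠ 1 := fun h => hA.notMem_of_leaf hU h hv
    omega
  have hl : (leaves G).ncard ≤ A.ncard := by
    have hex : ∀ v : V, ∃ w, G.Adj v w := fun v => (Set.ncard_pos).1 (hU.deg_pos v)
    choose f hf using hex
    refine Set.ncard_le_ncard_of_injOn f (fun v hv => ?_) fun v hv w hw hvw => ?_
    · exact by_contra fun h => hA.notMem_of_leaf hU hv ((hA.bip (hf v)).2 h)
    · have hvA : f v ∈ A := by_contra fun h => hA.notMem_of_leaf hU hv ((hA.bip (hf v)).2 h)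
      exact h1 _ hvA v w (hf v).symm (hvw ▸ (hf w).symm) hv hw
  have hle : ∀ v ∈ Finset.univ, (if v ∈ A then 3 else 0) ≤ if v ∈ A then deg G v else 0 := by
    intro v _
    by_cases hv : v ∈ A
    · simpa [hv] using h3 v hv
    · simp [hv]
  have hc := hA.card_eq hU
  have hs := hA.sum_deg_eq_card hU
  have h3A : (∑ v, if v ∈ A then 3 else 0) = 3 * A.ncard := by
    rw [ncard_eq_sum, Finset.mul_sum]
    exact Finset.sum_congr rfl fun v _ => by simp
  have hsum := Finset.sum_le_sum hle
  have := (Finset.sum_eq_sum_iff_of_le hle).1 (by omega)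
  intro v hv
  have := this v (Finset.mem_univ _)
  simp only [hv, if_true] at this
  exact this.symm

/-- A cycle, traversed periodically. -/
theorem UniConn.exists_periodic [Fintype V] (hU : UniConn G) :
    ∃ n, 3 ≤ n ∧ ∃ g : ℕ → V, (∀ i, G.Adj (g i) (g (i + 1))) ∧
      ∀ i j, g i = g j ↔ i ≡ j [MOD n] := by
  have hac : ¬ G.IsAcyclic := by
    intro h
    have h1 := SimpleGraph.IsTree.card_edgeFinset ⟨hU.conn, h⟩
    have h2 := sum_deg_eq G
    rw [hU.sum_deg] at h2
    omega
  rw [SimpleGraph.isAcyclic_iff_free_cycleGraph] at hac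
  push Not at hac
  obtain ⟨n, hn, hc⟩ := hac
  obtain ⟨c⟩ := hc
  refine ⟨n, hn, fun i => c ⟨i % n, Nat.mod_lt _ (by omega)⟩, fun i => ?_, fun i j => ?_⟩
  · refine c.toHom.map_adj (cycleGraph_adj_iff.2 ?_)
    have h1 := Nat.mod_lt i (show 0 < n by omega)
    simp only
    rw [Nat.add_mod i 1 n, Nat.mod_eq_of_lt (show 1 < n by omega)]
    by_cases h : i % n + 1 = n
    · rw [h, Nat.mod_self]
      omega
    · rw [Nat.mod_eq_of_lt (show i % n + 1 < n by omega)]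
      omega
  · exact (c.injective.eq_iff (a := ⟨i % n, _⟩) (b := ⟨j % n, _⟩)).trans Fin.ext_iff

theorem Core.nonempty_iso_baseGraph [Fintype V] (hU : UniConn G) {A : Set V} (hA : Core G A)
    (h3 : ∀ v ∈ A, deg G v = 3) : ∃ m, 2 ≤ m ∧ Nonempty (baseGraph m ≃g G) := by
  obtain ⟨n, hn, g, hadj, hg, h0⟩ : ∃ n, 3 ≤ n ∧ ∃ g : ℕ → V, (∀ i, G.Adj (g i) (g (i + 1))) ∧
      (∀ i j, g i = g j ↔ i ≡ j [MOD n]) ∧ g 0 ∈ A := by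
    obtain ⟨n, hn, g, hadj, hg⟩ := hU.exists_periodic
    by_cases h0 : g 0 ∈ A
    · exact ⟨n, hn, g, hadj, hg, h0⟩
    -- Shift the cycle by one so that it starts in `A`; its even positions are then those in `A`,
    -- and its length is even.
    · refine ⟨n, hn, fun i => g (i + 1), fun i => hadj _, fun i j => ?_, ?_⟩
      · rw [hg]
        exact ⟨fun h => Nat.ModEq.add_right_cancel' 1 h, fun h => h.add_right 1⟩
      · exact by_contra fun h => h0 ((hA.bip (hadj 0)).2 h)
  have hpar : ∀ i, g i ∈ A ↔ Even i := by
    intro i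
    induction i with
    | zero => simpa using h0
    | succ i ih =>
      rw [Nat.even_add_one, ← ih, hA.bip (hadj i), not_not]
  obtain ⟨m, hm⟩ : Even n := by
    rw [← hpar, (hg n 0).2 (by simp [Nat.ModEq])]
    exact h0
  obtain rfl : n = 2 * m := by omega
  have hdeg : ∀ i, deg G (g i) ≠ 1 := by
    intro i
    -- Moving one period ahead gives `g i` a predecessor without subtracting from `i`. Its two cycle
    -- neighbors differ because $2m\ge3$ does not divide 2.
    have hi : g i = g (i + (2 * m - 1) + 1) := by
      rw [hg, show i + (2 * m - 1) + 1 = i + 2 * m by omega]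
      simp [Nat.ModEq]
    rw [hi]
    refine deg_ne_one_of_adj_of_adj (hadj _).symm (hadj _) ?_
    rw [Ne, hg]
    intro h
    have h := Nat.ModEq.add_left_cancel' (i + (2 * m - 1)) (a := 0) (b := 2) h
    have h := (Nat.modEq_zero_iff_dvd.1 h.symm)
    have := Nat.le_of_dvd (by omega) h
    omega
  have hinj : ∀ i j, i < 2 * m → j < 2 * m → g i = g j → i = j := fun i j hi hj h =>
    Nat.ModEq.eq_of_lt_of_lt ((hg i j).1 h) hi hj
  have hleaf : ∀ i : Fin m, ∃ u, G.Adj (g (2 * i.val)) u ∧ deg G u = 1 := fun i =>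
    hA.leaf ((hpar _).2 (even_two_mul _))
  choose l hl hld using hleaf
  let F : baseGraph m →g G :=
    ⟨Sum.elim (fun a => g a.val) l, by
      rintro (a | a) (b | b) hab
      · have hab := cycleGraph_adj_iff.1 (show (SimpleGraph.cycleGraph (2 * m)).Adj a b from hab)
        change G.Adj (g a.val) (g b.val)
        have hend : g (2 * m) = g 0 := (hg _ _).2 (by simp [Nat.ModEq])
        rcases hab.2 with h | h | ⟨h, h'⟩ | ⟨h, h'⟩
        · exact h ▸ hadj _
        · exact h ▸ (hadj _).symm
        · have := hadj b.val
          rw [h', hend, ← h] at this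
          exact this.symm
        · have := hadj a.val
          rwa [h', hend, ← h] at this
      · have hab : a.val = 2 * b.val := hab
        change G.Adj (g a.val) (l b)
        exact hab ▸ hl b
      · have hab : b.val = 2 * a.val := hab
        change G.Adj (l a) (g b.val)
        exact hab ▸ (hl a).symm
      · exact hab.elim⟩
  have : Nonempty (Fin (2 * m) ⊕ Fin m) := ⟨.inr ⟨0, by omega⟩⟩
  refine ⟨m, by omega, nonempty_iso_of_injective F ?_ hU.conn ?_⟩
  · rintro (a | a) (b | b) hab
    · exact congrArg _ (Fin.ext (hinj _ _ a.2 b.2 hab))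
    · have hab : g a.val = l b := hab
      exact absurd (hab ▸ hld b) (hdeg _)
    · have hab : l a = g b.val := hab
      exact absurd (hab ▸ hld a) (hdeg _)
    · have hab : l a = l b := hab
      have h := eq_of_deg_eq_one (hld a) (hl a).symm (hab ▸ (hl b).symm)
      have := hinj _ _ (by omega) (by omega) h
      exact congrArg _ (Fin.ext (by omega))
  · rintro (a | a)
    · change deg G (g a.val) ≤ _
      rcases Nat.even_or_odd a.val with h | h
      · rw [deg_baseGraph_even (by omega) a h, h3 _ ((hpar _).2 h)]
      · rw [deg_baseGraph_odd (by omega) a h]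
        have := hA.low (x := g a.val) (by rw [hpar]; exact Nat.not_even_iff_odd.2 h)
        omega
    · change deg G (l a) ≤ _
      rw [deg_baseGraph_inr, hld]

universe u

theorem family_of_core (k : ℕ) : ∀ {V : Type u} [Fintype V] {G : SimpleGraph V},
    Fintype.card V = k → UniConn G → (∃ A, Core G A) → Family G := by
  induction k using Nat.strong_induction_on with
  | _ k ih =>
    rintro V _ G rfl hU ⟨A, hA⟩
    have ih' : ∀ (S : Set V) [Fintype S], Fintype.card S < Fintype.card V → UniConn (G.induce S) →
        (∃ B, Core (G.induce S) B) → Family (G.induce S) := fun S _ hS => ih _ hS rfl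
    by_cases h1 : ∀ v ∈ A, ∀ u x, G.Adj v u → G.Adj v x → deg G u = 1 → deg G x = 1 → u = x
    · by_cases h2 : ∀ v ∈ A, deg G v ≠ 2
      · obtain ⟨m, hm, ⟨e⟩⟩ := hA.nonempty_iso_baseGraph hU (hA.deg_eq_three hU h1 h2)
        exact Family.base m hm e
      · push Not at h2
        obtain ⟨b, hb, hd⟩ := h2
        obtain ⟨c, hc, hdc⟩ := hA.leaf hb
        exact family_of_pendant_path hU hA hb hc hd hdc
          (fun x hx hdx => h1 b hb x c hx hc hdx hdc) ih'
    · push Not at h1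
      obtain ⟨v, hv, u, x, hu, hx, hdu, hdx, hux⟩ := h1
      exact family_of_two_leaves hU hA hv hux hu hx hdu hdx ih'

end BaseCase

end Alliance

theorem mainTheorem2 {V : Type*} [Fintype V] (G : SimpleGraph V)
    (hconn : G.Connected) (huni : Alliance.IsUnicycle G) :
    (Alliance.goaNumber G : ℚ) =
        ((Fintype.card V : ℚ) - (Alliance.leaves G).ncard + (Alliance.supports G).ncard) / 3 ↔
      Alliance.Family G := by
  have hU := Alliance.uniConn_of_isUnicycle hconn huni
  rw [Alliance.goaNumber_eq_iff_exists_core hU]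
  exact ⟨Alliance.family_of_core _ rfl hU, fun h => h.exists_core.imp fun _ hA => hA.1⟩
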